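/- Let $m \le n$, let $A_\star\in\mathbb R^{n\times n}$, $B_\star\in\mathbb R^{n\times m}$ with $(A_\star,B_\star)$ stabilizable, and let $Q\in\mathbb R^{n\times n}$, $R\in\mathbb R^{m\times m}$ be symmetric with $Q\succeq I$, $R\succeq I$. Consider the system $x_{t+1}=A_\star x_t+B_\star u_t+w_t$, where $w_t$ is zero-mean white noise (uncorrelated in time) with $\mathbb E(w_tw_t^\top)=\sigma_w^2 I$, and the random initial state $x_0$ has mean $0$ and $\mathbb E(x_0x_0^\top)=\sigma_x^2 I$ and is uncorrelated with the noise. For a gain $K\in\mathbb R^{m\times n}$ put $$J_K=\lim_{T\to\infty}\frac1T\,\mathbb E\Big[\sum_{t=0}^{T-1}\big(x_t^\top Qx_t+u_t^\top Ru_t\big)\Big],\qquad u_t=-Kx_t .$$ Let $\mathcal R(P)=A_\star^\top P(I+B_\star R^{-1}B_\star^\top P)^{-1}A_\star+Q$ be the Riccati map and $\mathcal R^{(i)}$ its $i$-fold iterate, let $\mathcal K(F)=(R+B_\star^\top FB_\star)^{-1}B_\star^\top FA_\star$, let $P_\star$ be the (unique) positive definite solution of $P_\star=\mathcal R(P_\star)$,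 and let $K_\star=\mathcal K(P_\star)$. Let $\|\cdot\|$ be the spectral norm, $\overline\sigma$ and $\underline\sigma$ the largest and smallest singular values, and $\beta_\star=\overline\sigma(P_\star)/\underline\sigma(Q)$. Let $\varepsilon_{\mathrm m}\ge 0$ and let $\Upsilon_\star\ge\max\{1,\varepsilon_{\mathrm m}\}$ be an upper bound for $\|A_\star\|,\|B_\star\|,\|P_\star\|$. Let $N\ge1$ and let $P$ be a symmetric positive semidefinite $n\times n$ matrix with $\|P-P_\star\|\le\varepsilon_{\mathrm p}$, and let $K_{\mathrm{mpc}}=\mathcal K\big(\mathcal R^{(N-1)}(P)\big)$ be the gain of the receding-horizon LQ controller with the exact model, horizon $N$ and terminal cost matrix $P$. Suppose that $$\beta_\star(1-\beta_\star^{-1})^{N-1}\varepsilon_{\mathrm p}\le\Upsilon_\star\quad\text{and}\quad \varepsilon_{\mathrm m}+\beta_\star(1-\beta_\star^{-1})^{N-1}\varepsilon_{\mathrm p}\le\frac{\underline\sigma(R)}{40\,\Upsilon_\star^4\,\|P_\star\|^{3/2}} .$$ Then $A_\star-B_\star K_{\mathrm{mpc}}$ is stable (its spectral radius is less than $1$),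 the limits $J_{K_{\mathrm{mpc}}}$ and $J_{K_\star}$ exist, and $$J_{K_{\mathrm{mpc}}}-J_{K_\star}\le 32\,m\,\sigma_w^2\,\Upsilon_\star^4\big(\sqrt{\|P_\star\|}+1\big)^2\|P_\star\|\,\big(\overline\sigma(R)+\Upsilon_\star^3\big)\,\beta_\star^2\,(1-\beta_\star^{-1})^{2(N-1)}\,\varepsilon_{\mathrm p}^2 .$$ -/

import Mathlib

open MeasureTheory Filter Topology
open scoped Matrix Matrix.Norms.L2Operator

noncomputable section

namespace LQRHC

/-- A real square matrix is (Schur) stable if its spectral radius, computed over the complex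
eigenvalues, is less than one. -/
def SchurStable {n : ℕ} (M : Matrix (Fin n) (Fin n) ℝ) : Prop :=
  spectralRadius ℂ (M.map Complex.ofReal) < 1

/-- `(A, B)` is stabilizable: some static feedback `u = -K x` makes the closed loop stable. -/
def Stabilizable {n m : ℕ} (A : Matrix (Fin n) (Fin n) ℝ) (B : Matrix (Fin n) (Fin m) ℝ) : Prop :=
  ∃ K : Matrix (Fin m) (Fin n) ℝ, SchurStable (A - B * K)

/-- The largest singular value of a square matrix (Mathlib lists the singular values in
decreasing order, starting at index `0`). -/
def sigmaMax {k : ℕ} (M : Matrix (Fin k) (Fin k) ℝ) : ℝ :=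
  (Matrix.toEuclideanLin M).singularValues 0

/-- The smallest singular value of a square matrix of size `k`, namely the one of index `k - 1`. -/
def sigmaMin {k : ℕ} (M : Matrix (Fin k) (Fin k) ℝ) : ℝ :=
  (Matrix.toEuclideanLin M).singularValues (k - 1)

/-- The Riccati map `P ↦ Aᵀ P (I + S_B P)⁻¹ A + Q`, where `S_B = B R⁻¹ Bᵀ`. -/
def riccatiMap {n m : ℕ} (A : Matrix (Fin n) (Fin n) ℝ) (B : Matrix (Fin n) (Fin m) ℝ)
    (Q : Matrix (Fin n) (Fin n) ℝ) (R : Matrix (Fin m) (Fin m) ℝ)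
    (P : Matrix (Fin n) (Fin n) ℝ) : Matrix (Fin n) (Fin n) ℝ :=
  Aᵀ * P * (1 + B * R⁻¹ * Bᵀ * P)⁻¹ * A + Q

/-- The feedback gain `(R + Bᵀ F B)⁻¹ Bᵀ F A` associated with a cost-to-go matrix `F`. -/
def gain {n m : ℕ} (A : Matrix (Fin n) (Fin n) ℝ) (B : Matrix (Fin n) (Fin m) ℝ)
    (R : Matrix (Fin m) (Fin m) ℝ) (F : Matrix (Fin n) (Fin n) ℝ) : Matrix (Fin m) (Fin n) ℝ :=
  (R + Bᵀ * F * B)⁻¹ * Bᵀ * F * A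

/-- The gain of the receding-horizon controller with model `(A, B)`, terminal cost matrix `P` and
prediction horizon `N ≥ 1`: the gain associated with the `(N-1)`-st Riccati iterate of `P`. -/
def rhcGain {n m : ℕ} (A : Matrix (Fin n) (Fin n) ℝ) (B : Matrix (Fin n) (Fin m) ℝ)
    (Q : Matrix (Fin n) (Fin n) ℝ) (R : Matrix (Fin m) (Fin m) ℝ)
    (P : Matrix (Fin n) (Fin n) ℝ) (N : ℕ) : Matrix (Fin m) (Fin n) ℝ :=
  gain A B R ((riccatiMap A B Q R)^[N - 1] P)

/-- `P` is a positive definite solution of the discrete-time algebraic Riccati equation. -/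
structure IsDARESolution {n m : ℕ} (A : Matrix (Fin n) (Fin n) ℝ) (B : Matrix (Fin n) (Fin m) ℝ)
    (Q : Matrix (Fin n) (Fin n) ℝ) (R : Matrix (Fin m) (Fin m) ℝ)
    (P : Matrix (Fin n) (Fin n) ℝ) : Prop where
  posDef : P.PosDef
  eq : P = riccatiMap A B Q R P

/-- The second-order assumptions on the initial state `x₀` and the noise `w`: everything is square
integrable, `w` is white (centered, uncorrelated in time) with covariance `σw² I`, and `x₀` is
centered with covariance `σx² I` and uncorrelated with `w`. -/
structure IsDisturbance {n : ℕ} {Ω : Type*} [MeasurableSpace Ω] (μ : Measure Ω)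
    (x₀ : Ω → Fin n → ℝ) (w : ℕ → Ω → Fin n → ℝ) (σx σw : ℝ) : Prop where
  memLp_init : ∀ i, MemLp (fun ω => x₀ ω i) 2 μ
  memLp_noise : ∀ t i, MemLp (fun ω => w t ω i) 2 μ
  mean_init : ∀ i, ∫ ω, x₀ ω i ∂μ = 0
  mean_noise : ∀ t i, ∫ ω, w t ω i ∂μ = 0
  cov_init : ∀ i j, ∫ ω, x₀ ω i * x₀ ω j ∂μ = if i = j then σx ^ 2 else 0
  cov_noise : ∀ t i j, ∫ ω, w t ω i * w t ω j ∂μ = if i = j then σw ^ 2 else 0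
  noise_uncorrelated : ∀ s t, s ≠ t → ∀ i j, ∫ ω, w s ω i * w t ω j ∂μ = 0
  init_noise_uncorrelated : ∀ t i j, ∫ ω, x₀ ω i * w t ω j ∂μ = 0

/-- The state of `x_{t+1} = A x_t + B u_t + w_t` under the linear static controller
`u_t = -K x_t`. -/
def state {n m : ℕ} {Ω : Type*} (A : Matrix (Fin n) (Fin n) ℝ) (B : Matrix (Fin n) (Fin m) ℝ)
    (K : Matrix (Fin m) (Fin n) ℝ) (x₀ : Ω → Fin n → ℝ) (w : ℕ → Ω → Fin n → ℝ) :
    ℕ → Ω → Fin n → ℝ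
  | 0, ω => x₀ ω
  | t + 1, ω =>
      A *ᵥ state A B K x₀ w t ω + B *ᵥ (-(K *ᵥ state A B K x₀ w t ω)) + w t ω

/-- The stage cost `xᵀ Q x + uᵀ R u`. -/
def stageCost {n m : ℕ} (Q : Matrix (Fin n) (Fin n) ℝ) (R : Matrix (Fin m) (Fin m) ℝ)
    (x : Fin n → ℝ) (u : Fin m → ℝ) : ℝ :=
  x ⬝ᵥ (Q *ᵥ x) + u ⬝ᵥ (R *ᵥ u)

/-- `J` is the average infinite-horizon performance of the controller `u_t = -K x_t`:
the limit, as `T → ∞`, of `1/T` times the expected cost over the first `T` steps. -/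
def HasAveragePerformance {n m : ℕ} {Ω : Type*} [MeasurableSpace Ω] (μ : Measure Ω)
    (A : Matrix (Fin n) (Fin n) ℝ) (B : Matrix (Fin n) (Fin m) ℝ)
    (Q : Matrix (Fin n) (Fin n) ℝ) (R : Matrix (Fin m) (Fin m) ℝ)
    (x₀ : Ω → Fin n → ℝ) (w : ℕ → Ω → Fin n → ℝ)
    (K : Matrix (Fin m) (Fin n) ℝ) (J : ℝ) : Prop :=
  Tendsto
    (fun T : ℕ => (1 / (T : ℝ)) *
      ∫ ω, ∑ t ∈ Finset.range T,
        stageCost Q R (state A B K x₀ w t ω) (-(K *ᵥ state A B K x₀ w t ω)) ∂μ)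
    atTop (𝓝 J)

/-- The system parameter `β = σ̄(P) / σ̲(Q)`. -/
def decayParam {n : ℕ} (P Q : Matrix (Fin n) (Fin n) ℝ) : ℝ :=
  sigmaMax P / sigmaMin Q

end LQRHC

end

/-! With `X = K - K⋆`, `L = A - B K`, `G = R + Bᵀ P⋆ B` and `Γ = ∑ Lʲ (Lʲ)ᵀ`, the state covariance
converges to `σw² Γ`. Completing the square in the Bellman equation of `P⋆`
(`trace_costMatrix_mul_gramian`) turns the average cost into `σw² (tr P⋆ + tr (G X Γ Xᵀ))`. The
excess cost is thus quadratic in the gain error, which is why `εp` enters squared.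

The gain error is linear in `‖F - P⋆‖`, where `F` is the Riccati iterate (`mul_gain_sub_gain`). That
distance decays geometrically: measured relative to the form of `P⋆`, each Riccati step contracts by
`1 - β⁻¹`, since it is a minimum over gains and `Q ≥ β⁻¹ P⋆` (`abs_quad_riccatiMap_sub_le`).

Finally, `P⋆` is a Lyapunov function of the optimal loop with decrease at least `xᵀ Q x ≥ |x|²`. The
smallness assumption lets a perturbed loop keep half of this decrease (`quad_perturbed_le`), which
gives stability and `‖Γ‖ ≤ 2 ‖P⋆‖²`. -/

namespace LQRHC

/-! ### Quadratic forms and the spectral norm. -/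

/-- The quadratic form `x ↦ xᵀ M x`. -/
def quad {k : ℕ} (M : Matrix (Fin k) (Fin k) ℝ) (x : Fin k → ℝ) : ℝ := x ⬝ᵥ (M *ᵥ x)

lemma quad_add {k : ℕ} (M N : Matrix (Fin k) (Fin k) ℝ) (x : Fin k → ℝ) :
    quad (M + N) x = quad M x + quad N x := by
  simp [quad, Matrix.add_mulVec]

lemma quad_sub {k : ℕ} (M N : Matrix (Fin k) (Fin k) ℝ) (x : Fin k → ℝ) :
    quad (M - N) x = quad M x - quad N x := by
  simp [quad, Matrix.sub_mulVec]

lemma quad_one {k : ℕ} (x : Fin k → ℝ) : quad 1 x = x ⬝ᵥ x := by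
  simp [quad]

lemma quad_transpose_mul_mul {k l : ℕ} (M : Matrix (Fin k) (Fin k) ℝ)
    (L : Matrix (Fin k) (Fin l) ℝ) (x : Fin l → ℝ) :
    quad (Lᵀ * M * L) x = quad M (L *ᵥ x) := by
  simp only [quad, ← Matrix.mulVec_mulVec]
  rw [Matrix.mulVec_transpose, dotProduct_comm, ← Matrix.dotProduct_mulVec, dotProduct_comm]

lemma quad_nonneg {k : ℕ} {M : Matrix (Fin k) (Fin k) ℝ} (hM : M.PosSemidef) (x : Fin k → ℝ) :
    0 ≤ quad M x := by
  simpa [quad] using hM.dotProduct_mulVec_nonneg x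

lemma posSemidef_transpose_mul_mul {k l : ℕ} {M : Matrix (Fin k) (Fin k) ℝ} (hM : M.PosSemidef)
    (L : Matrix (Fin k) (Fin l) ℝ) : (Lᵀ * M * L).PosSemidef := by
  simpa using hM.conjTranspose_mul_mul_same L

lemma isSymm_of_posSemidef {k : ℕ} {M : Matrix (Fin k) (Fin k) ℝ} (hM : M.PosSemidef) :
    Mᵀ = M := by
  simpa [Matrix.IsHermitian] using hM.isHermitian

lemma dotProduct_self_eq_norm_sq {k : ℕ} (x : Fin k → ℝ) :
    x ⬝ᵥ x = ‖WithLp.toLp 2 x‖ ^ 2 := by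
  rw [EuclideanSpace.real_norm_sq_eq]
  simp [dotProduct, sq]

lemma zero_le_dotProduct_self {k : ℕ} (x : Fin k → ℝ) : 0 ≤ x ⬝ᵥ x := by
  rw [dotProduct_self_eq_norm_sq]; positivity

lemma norm_le_of_mulVec {k l : ℕ} (M : Matrix (Fin k) (Fin l) ℝ) {c : ℝ} (hc : 0 ≤ c)
    (h : ∀ x, (M *ᵥ x) ⬝ᵥ (M *ᵥ x) ≤ c ^ 2 * (x ⬝ᵥ x)) : ‖M‖ ≤ c := by
  rw [Matrix.l2_opNorm_def]
  refine ContinuousLinearMap.opNorm_le_bound _ hc fun x => ?_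
  have := h x.ofLp
  rw [dotProduct_self_eq_norm_sq, dotProduct_self_eq_norm_sq, ← mul_pow] at this
  exact le_of_sq_le_sq this (by positivity)

lemma abs_dotProduct_le {k : ℕ} (x y : Fin k → ℝ) :
    |x ⬝ᵥ y| ≤ ‖WithLp.toLp 2 x‖ * ‖WithLp.toLp 2 y‖ := by
  have := abs_real_inner_le_norm (WithLp.toLp 2 y) (WithLp.toLp 2 x)
  rw [mul_comm]
  simpa [EuclideanSpace.inner_eq_star_dotProduct] using this

lemma norm_toLp_mulVec_le {k l : ℕ} (M : Matrix (Fin k) (Fin l) ℝ) (x : Fin l → ℝ) :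
    ‖WithLp.toLp 2 (M *ᵥ x)‖ ≤ ‖M‖ * ‖WithLp.toLp 2 x‖ := by
  simpa using Matrix.l2_opNorm_mulVec M (WithLp.toLp 2 x)

lemma abs_quad_le {k : ℕ} (M : Matrix (Fin k) (Fin k) ℝ) (x : Fin k → ℝ) :
    |quad M x| ≤ ‖M‖ * (x ⬝ᵥ x) := by
  refine (abs_dotProduct_le _ _).trans ?_
  have := mul_le_mul_of_nonneg_left (norm_toLp_mulVec_le M x) (norm_nonneg (WithLp.toLp 2 x))
  rw [dotProduct_self_eq_norm_sq]
  linarith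

lemma quad_add_vec {k : ℕ} {M : Matrix (Fin k) (Fin k) ℝ} (hM : Mᵀ = M) (x y : Fin k → ℝ) :
    quad M (x + y) = quad M x + 2 * (y ⬝ᵥ (M *ᵥ x)) + quad M y := by
  have h : x ⬝ᵥ (M *ᵥ y) = y ⬝ᵥ (M *ᵥ x) := by
    rw [Matrix.dotProduct_mulVec, ← Matrix.mulVec_transpose, hM, dotProduct_comm]
  simp only [quad, Matrix.mulVec_add, dotProduct_add, add_dotProduct, h]
  ring

lemma quad_smul_vec {k : ℕ} (M : Matrix (Fin k) (Fin k) ℝ) (c : ℝ) (x : Fin k → ℝ) :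
    quad M (c • x) = c ^ 2 * quad M x := by
  simp [quad, Matrix.mulVec_smul]; ring

/-- Polarization: comparing the form at `x ± d⁻¹ M x` and using the parallelogram law bounds `|M
x|²` by `d² |x|²`. Taking `d = c + e` with `e > 0` permits the division when `c = 0`. -/
lemma norm_le_of_abs_quad_le {k : ℕ} {M : Matrix (Fin k) (Fin k) ℝ} (hM : Mᵀ = M) {c : ℝ}
    (hc : 0 ≤ c) (h : ∀ x, |quad M x| ≤ c * (x ⬝ᵥ x)) : ‖M‖ ≤ c := by
  refine le_of_forall_pos_le_add fun e he => ?_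
  set d := c + e
  have hd : 0 < d := by positivity
  refine norm_le_of_mulVec M hd.le fun x => ?_
  set y := M *ᵥ x with hy
  have h1 := (abs_le.1 (h (x + d⁻¹ • y))).2
  have h2 := (abs_le.1 (h (x + (-d⁻¹) • y))).1
  rw [quad_add_vec hM, quad_smul_vec, ← hy] at h1 h2
  simp only [smul_dotProduct, dotProduct_smul, dotProduct_add, add_dotProduct, smul_eq_mul] at h1 h2
  have hs := zero_le_dotProduct_self (x + d⁻¹ • y)
  have h3 : 4 * (d⁻¹ * (y ⬝ᵥ y)) ≤ 2 * c * (x ⬝ᵥ x + d⁻¹ ^ 2 * (y ⬝ᵥ y)) := by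
    nlinarith
  have hx := zero_le_dotProduct_self x
  have hyy := zero_le_dotProduct_self y
  have h4 : 4 * (d⁻¹ * (y ⬝ᵥ y)) ≤ 2 * d * (x ⬝ᵥ x + d⁻¹ ^ 2 * (y ⬝ᵥ y)) := by
    refine h3.trans ?_
    gcongr
    simp only [d]; linarith
  have h5 : 2 * d * (x ⬝ᵥ x + d⁻¹ ^ 2 * (y ⬝ᵥ y)) = 2 * d * (x ⬝ᵥ x) + 2 * (d⁻¹ * (y ⬝ᵥ y)) := by
    field_simp
  have h6 : d⁻¹ * (y ⬝ᵥ y) ≤ d * (x ⬝ᵥ x) := by linarith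
  rw [inv_mul_le_iff₀ hd] at h6
  linarith

lemma norm_transpose {k l : ℕ} (M : Matrix (Fin k) (Fin l) ℝ) : ‖Mᵀ‖ = ‖M‖ := by
  simpa using Matrix.l2_opNorm_conjTranspose M

lemma trace_le {k : ℕ} (M : Matrix (Fin k) (Fin k) ℝ) : M.trace ≤ k * ‖M‖ := by
  have : ∀ i, M i i ≤ ‖M‖ := fun i => by
    have := (le_abs_self _).trans (abs_quad_le M (Pi.single i 1))
    simpa [quad] using this
  calc M.trace ≤ ∑ _i : Fin k, ‖M‖ := Finset.sum_le_sum fun i _ => this i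
    _ = k * ‖M‖ := by simp

/-! ### Extreme singular values as bounds for norms and quadratic forms. -/

section SingularValues

variable {E : Type*} [NormedAddCommGroup E] [InnerProductSpace ℝ E]

lemma norm_sq_eq_sum_inner_sq {k : ℕ} (b : OrthonormalBasis (Fin k) ℝ E) (x : E) :
    ‖x‖ ^ 2 = ∑ i, (inner ℝ (b i) x) ^ 2 := by
  simpa using (b.sum_sq_norm_inner_right x).symm

variable [FiniteDimensional ℝ E]

lemma inner_apply_eq_sum_eigenvalues {T : E →ₗ[ℝ] E} (hT : T.IsSymmetric) {k : ℕ}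
    (hk : Module.finrank ℝ E = k) (x : E) :
    inner ℝ x (T x) = ∑ i, hT.eigenvalues hk i * (inner ℝ (hT.eigenvectorBasis hk i) x) ^ 2 := by
  rw [← OrthonormalBasis.sum_inner_mul_inner (hT.eigenvectorBasis hk) x (T x)]
  refine Finset.sum_congr rfl fun i _ => ?_
  rw [← hT, hT.apply_eigenvectorBasis, real_inner_comm x]
  rw [real_inner_smul_right, real_inner_comm]
  simp only [RCLike.ofReal_real_eq_id, id]
  ring

lemma norm_sq_apply_eq_inner (T : E →ₗ[ℝ] E) (x : E) :
    ‖T x‖ ^ 2 = inner ℝ x ((T.adjoint ∘ₗ T) x) := by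
  rw [LinearMap.comp_apply, LinearMap.adjoint_inner_right, real_inner_self_eq_norm_sq]

lemma norm_apply_le_singularValues (T : E →ₗ[ℝ] E) (x : E) :
    ‖T x‖ ≤ T.singularValues 0 * ‖x‖ := by
  refine le_of_sq_le_sq ?_ (mul_nonneg (T.singularValues_nonneg 0) (norm_nonneg x))
  rw [norm_sq_apply_eq_inner, inner_apply_eq_sum_eigenvalues T.isSymmetric_adjoint_comp_self rfl,
    mul_pow, norm_sq_eq_sum_inner_sq (T.isSymmetric_adjoint_comp_self.eigenvectorBasis rfl) x,
    Finset.mul_sum]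
  refine Finset.sum_le_sum fun i _ => ?_
  rw [← T.sq_singularValues_fin rfl i]
  have := T.singularValues_antitone (Nat.zero_le i)
  have := T.singularValues_nonneg i
  gcongr

lemma singularValues_le_norm_apply (T : E →ₗ[ℝ] E) (x : E) :
    T.singularValues (Module.finrank ℝ E - 1) * ‖x‖ ≤ ‖T x‖ := by
  refine le_of_sq_le_sq ?_ (norm_nonneg _)
  rw [norm_sq_apply_eq_inner, inner_apply_eq_sum_eigenvalues T.isSymmetric_adjoint_comp_self rfl,
    mul_pow, norm_sq_eq_sum_inner_sq (T.isSymmetric_adjoint_comp_self.eigenvectorBasis rfl) x,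
    Finset.mul_sum]
  refine Finset.sum_le_sum fun i _ => ?_
  rw [← T.sq_singularValues_fin rfl i]
  have := T.singularValues_antitone (show (i : ℕ) ≤ Module.finrank ℝ E - 1 by omega)
  have := T.singularValues_nonneg (Module.finrank ℝ E - 1)
  gcongr

/-- An eigenvalue of a positive operator is the norm of the image of its unit eigenvector, hence at
least the smallest singular value. -/
lemma singularValues_mul_norm_sq_le_inner {T : E →ₗ[ℝ] E} (hT : T.IsPositive) (x : E) :
    T.singularValues (Module.finrank ℝ E - 1) * ‖x‖ ^ 2 ≤ inner ℝ x (T x) := by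
  rw [inner_apply_eq_sum_eigenvalues hT.isSymmetric rfl,
    norm_sq_eq_sum_inner_sq (hT.isSymmetric.eigenvectorBasis rfl) x, Finset.mul_sum]
  refine Finset.sum_le_sum fun i _ => ?_
  gcongr
  have := singularValues_le_norm_apply T (hT.isSymmetric.eigenvectorBasis rfl i)
  rw [hT.isSymmetric.apply_eigenvectorBasis] at this
  simpa [norm_smul, abs_of_nonneg (hT.nonneg_eigenvalues rfl i)] using this

end SingularValues

lemma norm_le_sigmaMax {k : ℕ} (M : Matrix (Fin k) (Fin k) ℝ) : ‖M‖ ≤ sigmaMax M := by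
  rw [Matrix.l2_opNorm_def]
  exact ContinuousLinearMap.opNorm_le_bound _ (LinearMap.singularValues_nonneg _ _)
    fun x => norm_apply_le_singularValues (Matrix.toEuclideanLin M) x

lemma sigmaMin_mul_le_quad {k : ℕ} {M : Matrix (Fin k) (Fin k) ℝ} (hM : M.PosSemidef)
    (x : Fin k → ℝ) : sigmaMin M * (x ⬝ᵥ x) ≤ quad M x := by
  have h := singularValues_mul_norm_sq_le_inner
    (Matrix.isPositive_toEuclideanLin_iff.2 hM) (WithLp.toLp 2 x)
  rw [finrank_euclideanSpace_fin, ← dotProduct_self_eq_norm_sq] at h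
  refine h.trans_eq ?_
  simp [quad, EuclideanSpace.inner_eq_star_dotProduct, dotProduct_comm]

lemma sigmaMin_pos {k : ℕ} (hk : 0 < k) {M : Matrix (Fin k) (Fin k) ℝ} (hM : M.PosDef) :
    0 < sigmaMin M := by
  refine (LinearMap.injective_iff_forall_lt_finrank_singularValues_pos _).1 ?_ _
    (by rw [finrank_euclideanSpace_fin]; omega)
  rw [injective_iff_map_eq_zero]
  intro x hx
  by_contra hne
  have h := hM.dotProduct_mulVec_pos (x := x.ofLp) (by simpa using hne)
  have hx' : M *ᵥ x.ofLp = 0 := by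
    have := congrArg WithLp.ofLp hx
    simpa using this
  simp [hx'] at h

/-! ### The Riccati map: minimization over gains, contraction, sensitivity of the gain. -/

section Riccati

variable {n m : ℕ} {A : Matrix (Fin n) (Fin n) ℝ} {B : Matrix (Fin n) (Fin m) ℝ}
  {Q : Matrix (Fin n) (Fin n) ℝ} {R : Matrix (Fin m) (Fin m) ℝ}

/-- One step of policy evaluation for the gain `K`, started from the cost-to-go matrix `P`. -/
def costMap (A : Matrix (Fin n) (Fin n) ℝ) (B : Matrix (Fin n) (Fin m) ℝ)
    (Q : Matrix (Fin n) (Fin n) ℝ) (R : Matrix (Fin m) (Fin m) ℝ)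
    (K : Matrix (Fin m) (Fin n) ℝ) (P : Matrix (Fin n) (Fin n) ℝ) : Matrix (Fin n) (Fin n) ℝ :=
  (A - B * K)ᵀ * P * (A - B * K) + Q + Kᵀ * R * K

lemma quad_costMap (K : Matrix (Fin m) (Fin n) ℝ) (P : Matrix (Fin n) (Fin n) ℝ)
    (x : Fin n → ℝ) :
    quad (costMap A B Q R K P) x = quad P ((A - B * K) *ᵥ x) + quad Q x + quad R (K *ᵥ x) := by
  simp only [costMap, quad_add, quad_transpose_mul_mul]

lemma posSemidef_costMap (hQ : Q.PosSemidef) (hR : R.PosSemidef) (K : Matrix (Fin m) (Fin n) ℝ)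
    {P : Matrix (Fin n) (Fin n) ℝ} (hP : P.PosSemidef) : (costMap A B Q R K P).PosSemidef :=
  ((posSemidef_transpose_mul_mul hP _).add hQ).add (posSemidef_transpose_mul_mul hR _)

lemma posDef_add_transpose_mul_mul (hR : R.PosDef) {P : Matrix (Fin n) (Fin n) ℝ}
    (hP : P.PosSemidef) : (R + Bᵀ * P * B).PosDef :=
  hR.add_posSemidef (posSemidef_transpose_mul_mul hP _)

lemma mul_gain (hR : R.PosDef) {P : Matrix (Fin n) (Fin n) ℝ} (hP : P.PosSemidef) :
    (R + Bᵀ * P * B) * gain A B R P = Bᵀ * P * A := by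
  have hG := posDef_add_transpose_mul_mul (B := B) hR hP
  have := (Matrix.isUnit_iff_isUnit_det _).1 hG.isUnit
  have h : gain A B R P = (R + Bᵀ * P * B)⁻¹ * (Bᵀ * P * A) := by
    rw [gain]; simp only [Matrix.mul_assoc]
  rw [h, Matrix.mul_nonsing_inv_cancel_left _ _ this]

/-- Woodbury identity: `(1 + B R⁻¹ Bᵀ P)⁻¹ = 1 - B G⁻¹ Bᵀ P` with `G = R + Bᵀ P B`. -/
lemma riccatiMap_eq (hR : R.PosDef) {P : Matrix (Fin n) (Fin n) ℝ} (hP : P.PosSemidef) :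
    riccatiMap A B Q R P = Aᵀ * P * A + Q - Aᵀ * P * B * gain A B R P := by
  set G := R + Bᵀ * P * B with hG
  have hGu := (Matrix.isUnit_iff_isUnit_det _).1
    (posDef_add_transpose_mul_mul (B := B) hR hP).isUnit
  have hRu := (Matrix.isUnit_iff_isUnit_det _).1 hR.isUnit
  have hGG : G * G⁻¹ = 1 := Matrix.mul_nonsing_inv _ hGu
  have hRR : R⁻¹ * R = 1 := Matrix.nonsing_inv_mul _ hRu
  have hB : Bᵀ * P * B = G - R := by rw [hG]; abel
  have h1 : (1 + B * R⁻¹ * Bᵀ * P) * (1 - B * G⁻¹ * Bᵀ * P) = 1 := by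
    have h2 : B * R⁻¹ * Bᵀ * P * (B * G⁻¹ * Bᵀ * P)
        = B * R⁻¹ * (G * G⁻¹) * Bᵀ * P - B * (R⁻¹ * R) * G⁻¹ * Bᵀ * P := by
      calc B * R⁻¹ * Bᵀ * P * (B * G⁻¹ * Bᵀ * P)
          = B * R⁻¹ * (Bᵀ * P * B) * G⁻¹ * Bᵀ * P := by simp only [Matrix.mul_assoc]
        _ = _ := by
          rw [hB]; simp only [Matrix.mul_sub, Matrix.sub_mul, Matrix.mul_assoc]
    rw [hGG, hRR, Matrix.mul_one, Matrix.mul_one] at h2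
    rw [add_mul, mul_sub, mul_sub, one_mul, one_mul, mul_one, h2]
    abel
  rw [riccatiMap, Matrix.inv_eq_right_inv h1, gain, ← hG]
  simp only [Matrix.mul_sub, Matrix.sub_mul, Matrix.mul_one, Matrix.mul_assoc]
  abel

/-- Completion of squares for the policy evaluation step. -/
lemma costMap_eq_riccatiMap_add (hR : R.PosDef) {P : Matrix (Fin n) (Fin n) ℝ}
    (hP : P.PosSemidef) (K : Matrix (Fin m) (Fin n) ℝ) :
    costMap A B Q R K P = riccatiMap A B Q R P +
      (K - gain A B R P)ᵀ * (R + Bᵀ * P * B) * (K - gain A B R P) := by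
  have h1 := mul_gain (A := A) (B := B) hR hP
  have h2 : (gain A B R P)ᵀ * (R + Bᵀ * P * B) = Aᵀ * P * B := by
    have := congrArg Matrix.transpose h1
    simpa [Matrix.transpose_mul, isSymm_of_posSemidef hP, isSymm_of_posSemidef hR.posSemidef,
      Matrix.mul_assoc] using this
  have h3 : costMap A B Q R K P = Aᵀ * P * A + Q - Kᵀ * (Bᵀ * P * A) - Aᵀ * P * B * K
      + Kᵀ * (R + Bᵀ * P * B) * K := by
    simp only [costMap, Matrix.transpose_sub, Matrix.transpose_mul, Matrix.mul_sub, Matrix.sub_mul,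
      Matrix.mul_add, Matrix.add_mul, Matrix.mul_assoc]
    abel
  rw [h3, riccatiMap_eq hR hP, Matrix.transpose_sub, Matrix.sub_mul, Matrix.mul_sub, h2,
    Matrix.sub_mul, Matrix.sub_mul, Matrix.mul_assoc Kᵀ _ (gain A B R P), h1]
  abel

lemma riccatiMap_eq_costMap (hR : R.PosDef) {P : Matrix (Fin n) (Fin n) ℝ}
    (hP : P.PosSemidef) : riccatiMap A B Q R P = costMap A B Q R (gain A B R P) P := by
  simp [costMap_eq_riccatiMap_add hR hP]

lemma quad_riccatiMap_le (hR : R.PosDef) {P : Matrix (Fin n) (Fin n) ℝ}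
    (hP : P.PosSemidef) (K : Matrix (Fin m) (Fin n) ℝ) (x : Fin n → ℝ) :
    quad (riccatiMap A B Q R P) x ≤ quad (costMap A B Q R K P) x := by
  rw [costMap_eq_riccatiMap_add hR hP K, quad_add, quad_transpose_mul_mul]
  linarith [quad_nonneg (posDef_add_transpose_mul_mul (B := B) hR hP).posSemidef
    ((K - gain A B R P) *ᵥ x)]

lemma posSemidef_riccatiMap (hQ : Q.PosSemidef) (hR : R.PosDef) {P : Matrix (Fin n) (Fin n) ℝ}
    (hP : P.PosSemidef) : (riccatiMap A B Q R P).PosSemidef := by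
  rw [riccatiMap_eq_costMap hR hP]
  exact posSemidef_costMap hQ hR.posSemidef _ hP

lemma posSemidef_riccatiMap_iterate (hQ : Q.PosSemidef) (hR : R.PosDef)
    {P : Matrix (Fin n) (Fin n) ℝ} (hP : P.PosSemidef) (i : ℕ) :
    ((riccatiMap A B Q R)^[i] P).PosSemidef := by
  induction i with
  | zero => exact hP
  | succ i ih =>
    rw [Function.iterate_succ_apply']
    exact posSemidef_riccatiMap hQ hR ih

/-- The Riccati map contracts towards its fixed point in the relative order. -/
lemma abs_quad_riccatiMap_sub_le (hR : R.PosDef)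
    {Pstar : Matrix (Fin n) (Fin n) ℝ} (hPs : Pstar.PosSemidef)
    (hfix : Pstar = riccatiMap A B Q R Pstar) {b : ℝ} (hb : b ≤ 1)
    (hbQ : ∀ x, b * quad Pstar x ≤ quad Q x)
    {P : Matrix (Fin n) (Fin n) ℝ} (hP : P.PosSemidef) {δ : ℝ} (hδ : 0 ≤ δ)
    (h : ∀ x, |quad (P - Pstar) x| ≤ δ * quad Pstar x) (x : Fin n → ℝ) :
    |quad (riccatiMap A B Q R P - Pstar) x| ≤ δ * (1 - b) * quad Pstar x := by
  have hp := quad_nonneg hPs x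
  rw [abs_le, quad_sub]
  constructor
  -- Lower bound: the gain of `P` is suboptimal for `P⋆`.
  · have h1 := quad_riccatiMap_le (A := A) (B := B) (Q := Q) hR hPs (gain A B R P) x
    rw [← hfix, quad_costMap] at h1
    rw [riccatiMap_eq_costMap hR hP, quad_costMap]
    have h2 := (abs_le.1 (h ((A - B * gain A B R P) *ᵥ x))).1
    rw [quad_sub] at h2
    have h3 := quad_nonneg hP ((A - B * gain A B R P) *ᵥ x)
    have h4 := quad_nonneg hR.posSemidef (gain A B R P *ᵥ x)
    have h5 := hbQ x
    -- For `δ ≤ 1` the inequality `h1` may be scaled by `1 - δ`. For `δ ≥ 1`, positivity of `P`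
    -- already gives the value at least `b P⋆`, and `b ≥ 1 - δ (1 - b)`.
    rcases le_total δ 1 with h6 | h6
    · nlinarith [mul_le_mul_of_nonneg_left h1 (sub_nonneg.2 h6)]
    · nlinarith [mul_nonneg (mul_nonneg (sub_nonneg.2 h6) (sub_nonneg.2 hb)) hp]
  -- Upper bound: the gain of `P⋆` is suboptimal for `P`, and the optimal loop maps the form of `P⋆`
  -- below `(1 - b) P⋆`.
  · have h1 := quad_riccatiMap_le (A := A) (B := B) (Q := Q) hR hP (gain A B R Pstar) x
    have h2 : quad Pstar x = _ := congrArg (quad · x) (hfix.trans (riccatiMap_eq_costMap hR hPs))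
    simp only [quad_costMap] at h1 h2
    have h3 := (abs_le.1 (h ((A - B * gain A B R Pstar) *ᵥ x))).2
    rw [quad_sub] at h3
    have h4 := quad_nonneg hR.posSemidef (gain A B R Pstar *ᵥ x)
    have h5 := hbQ x
    nlinarith [mul_le_mul_of_nonneg_left h5 hδ, mul_nonneg hδ h4]

lemma abs_quad_riccatiMap_iterate_sub_le (hQ : Q.PosSemidef) (hR : R.PosDef)
    {Pstar : Matrix (Fin n) (Fin n) ℝ} (hPs : Pstar.PosSemidef)
    (hfix : Pstar = riccatiMap A B Q R Pstar) {b : ℝ} (hb : b ≤ 1)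
    (hbQ : ∀ x, b * quad Pstar x ≤ quad Q x)
    {P : Matrix (Fin n) (Fin n) ℝ} (hP : P.PosSemidef) {δ : ℝ} (hδ : 0 ≤ δ)
    (h : ∀ x, |quad (P - Pstar) x| ≤ δ * quad Pstar x) (i : ℕ) (x : Fin n → ℝ) :
    |quad ((riccatiMap A B Q R)^[i] P - Pstar) x| ≤ δ * (1 - b) ^ i * quad Pstar x := by
  induction i generalizing x with
  | zero => simpa using h x
  | succ i ih =>
    rw [Function.iterate_succ_apply', pow_succ, ← mul_assoc]
    exact abs_quad_riccatiMap_sub_le hR hPs hfix hb hbQ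
      (posSemidef_riccatiMap_iterate hQ hR hP i)
      (mul_nonneg hδ (pow_nonneg (sub_nonneg.2 hb) i)) ih x

/-- Subtracting the two normal equations leaves the optimal-type closed loop of `P` as a factor, so
the gain error is linear in `F - P`. -/
lemma mul_gain_sub_gain (hR : R.PosDef) {F P : Matrix (Fin n) (Fin n) ℝ} (hF : F.PosSemidef)
    (hP : P.PosSemidef) :
    (R + Bᵀ * F * B) * (gain A B R F - gain A B R P)
      = Bᵀ * (F - P) * (A - B * gain A B R P) := by
  have h1 := mul_gain (A := A) (B := B) hR hP
  have h2 : R * gain A B R P = Bᵀ * P * A - Bᵀ * P * B * gain A B R P := by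
    rw [← h1, Matrix.add_mul]; abel
  rw [Matrix.mul_sub, mul_gain hR hF, Matrix.add_mul, h2]
  simp only [Matrix.mul_sub, Matrix.sub_mul, Matrix.mul_assoc]
  abel

lemma mul_norm_le_norm_mul {k l : ℕ} {G : Matrix (Fin k) (Fin k) ℝ} {ρ : ℝ} (hρ : 0 ≤ ρ)
    (hG : ∀ x, ρ * (x ⬝ᵥ x) ≤ quad G x) (X : Matrix (Fin k) (Fin l) ℝ) :
    ρ * ‖X‖ ≤ ‖G * X‖ := by
  rcases hρ.eq_or_lt with rfl | hρ
  · simp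
  rw [← le_div_iff₀' hρ]
  refine norm_le_of_mulVec X (by positivity) fun x => ?_
  rw [dotProduct_self_eq_norm_sq, dotProduct_self_eq_norm_sq, ← mul_pow]
  gcongr
  have h1 := hG (X *ᵥ x)
  have h2 := (le_abs_self _).trans (abs_dotProduct_le (X *ᵥ x) (G *ᵥ (X *ᵥ x)))
  rw [Matrix.mulVec_mulVec] at h2
  have h3 := norm_toLp_mulVec_le (G * X) x
  rw [dotProduct_self_eq_norm_sq] at h1
  rw [div_mul_eq_mul_div, le_div_iff₀' hρ]
  rcases (norm_nonneg (WithLp.toLp 2 (X *ᵥ x))).eq_or_lt with h0 | h0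
  · rw [← h0, mul_zero]; positivity
  · refine le_trans ?_ h3
    refine le_of_mul_le_mul_left ?_ h0
    rw [quad, Matrix.mulVec_mulVec] at h1
    nlinarith

end Riccati

/-! ### Decay of powers, Schur stability and the Lyapunov equation. -/

section Gramian

variable {n : ℕ}

lemma schurStable_of_tendsto {L : Matrix (Fin n) (Fin n) ℝ}
    (h : Tendsto (fun j => L ^ j) atTop (𝓝 0)) : SchurStable L := by
  have hc : Continuous fun M : Matrix (Fin n) (Fin n) ℝ => M.map Complex.ofReal :=
    Continuous.matrix_map continuous_id Complex.continuous_ofReal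
  have h1 : Tendsto (fun j => (L.map Complex.ofReal) ^ j) atTop (𝓝 0) := by
    have h2 := (hc.tendsto 0).comp h
    have h3 : (0 : Matrix (Fin n) (Fin n) ℝ).map Complex.ofReal = 0 := by ext; simp
    rw [h3] at h2
    refine h2.congr fun j => ?_
    exact Matrix.map_pow (f := Complex.ofRealHom) L j
  have h4 := (tendsto_add_atTop_iff_nat 1).2 h1.nnnorm
  rw [nnnorm_zero] at h4
  obtain ⟨j, hj⟩ := (h4.eventually_lt_const zero_lt_one).exists
  refine lt_of_le_of_lt (spectrum.spectralRadius_le_pow_nnnorm_pow_one_div ℂ _ j) ?_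
  -- Only `≤ 1` is claimed, because the identity has norm `0` in dimension zero.
  have h5 : (‖(1 : Matrix (Fin n) (Fin n) ℂ)‖₊ : ENNReal) ^ (1 / (j + 1) : ℝ) ≤ 1 := by
    refine ENNReal.rpow_le_one ?_ (by positivity)
    rw [← Matrix.diagonal_one]
    have := Matrix.l2_opNNNorm_diagonal (𝕜 := ℂ) (n := Fin n) (fun _ => 1)
    rw [this]
    norm_cast
    rw [pi_nnnorm_le_iff]
    simp
  have h6 : (‖(L.map Complex.ofReal) ^ (j + 1)‖₊ : ENNReal) ^ (1 / (j + 1) : ℝ) < 1 := by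
    refine ENNReal.rpow_lt_one ?_ (by positivity)
    exact_mod_cast hj
  calc _ ≤ (‖(L.map Complex.ofReal) ^ (j + 1)‖₊ : ENNReal) ^ (1 / (j + 1) : ℝ) * 1 := by gcongr
    _ < 1 := by simpa using h6

/-- The controllability Gramian `∑ Lʲ (Lʲ)ᵀ` of a stable matrix `L`. -/
noncomputable def gramian (L : Matrix (Fin n) (Fin n) ℝ) : Matrix (Fin n) (Fin n) ℝ :=
  ∑' j : ℕ, L ^ j * (L ^ j)ᵀ

variable {L : Matrix (Fin n) (Fin n) ℝ} {C r : ℝ}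

lemma tendsto_pow_of_norm_sq_le (hr0 : 0 ≤ r) (hr1 : r < 1)
    (h : ∀ j, ‖L ^ j‖ ^ 2 ≤ C * r ^ j) : Tendsto (fun j => L ^ j) atTop (𝓝 0) := by
  rw [tendsto_zero_iff_norm_tendsto_zero]
  have h1 : Tendsto (fun j => ‖L ^ j‖ ^ 2) atTop (𝓝 0) := by
    refine squeeze_zero (fun j => by positivity) h ?_
    simpa using (tendsto_pow_atTop_nhds_zero_of_lt_one hr0 hr1).const_mul C
  have h2 := (Real.continuous_sqrt.tendsto 0).comp h1
  simpa [Function.comp_def, Real.sqrt_sq] using h2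

lemma norm_pow_mul_transpose_le (h : ∀ j, ‖L ^ j‖ ^ 2 ≤ C * r ^ j) (j : ℕ) :
    ‖L ^ j * (L ^ j)ᵀ‖ ≤ C * r ^ j := by
  refine (norm_mul_le _ _).trans ?_
  rw [norm_transpose, ← sq]
  exact h j

lemma norm_gramian_le (hr0 : 0 ≤ r) (hr1 : r < 1)
    (h : ∀ j, ‖L ^ j‖ ^ 2 ≤ C * r ^ j) : ‖gramian L‖ ≤ C / (1 - r) := by
  have h1 := (hasSum_geometric_of_lt_one hr0 hr1).mul_left C
  exact tsum_of_norm_bounded h1 (norm_pow_mul_transpose_le h)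

lemma gramian_eq (hr0 : 0 ≤ r) (hr1 : r < 1)
    (h : ∀ j, ‖L ^ j‖ ^ 2 ≤ C * r ^ j) : gramian L = L * gramian L * Lᵀ + 1 := by
  have hs : Summable fun j : ℕ => L ^ j * (L ^ j)ᵀ :=
    Summable.of_norm_bounded ((summable_geometric_of_lt_one hr0 hr1).mul_left C)
      (norm_pow_mul_transpose_le h)
  have h1 : gramian L = _ := hs.tsum_eq_zero_add
  conv_lhs => rw [h1]
  rw [gramian, ← hs.tsum_mul_left, ← (hs.mul_left L).tsum_mul_right, add_comm]
  congr 1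
  · refine tsum_congr fun j => ?_
    rw [pow_succ', Matrix.transpose_mul]
    simp only [mul_assoc]
  · simp

end Gramian

/-- Sandwich: `|Lʲ x|² ≤ P(Lʲ x) ≤ rʲ P(x) ≤ rʲ ‖P‖ |x|²`. -/
lemma norm_pow_sq_le_of_lyapunov {n : ℕ} {L P : Matrix (Fin n) (Fin n) ℝ} {r : ℝ} (hr0 : 0 ≤ r)
    (hP : ∀ x, x ⬝ᵥ x ≤ quad P x) (h : ∀ x, quad P (L *ᵥ x) ≤ r * quad P x) (j : ℕ) :
    ‖L ^ j‖ ^ 2 ≤ ‖P‖ * r ^ j := by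
  have h1 : ∀ x, quad P (L ^ j *ᵥ x) ≤ r ^ j * quad P x := by
    induction j with
    | zero => simp
    | succ j ih =>
      intro x
      rw [pow_succ', ← Matrix.mulVec_mulVec]
      refine (h _).trans ?_
      rw [pow_succ', mul_assoc]
      exact mul_le_mul_of_nonneg_left (ih x) hr0
  have hr := pow_nonneg hr0 j
  have h2 : ‖L ^ j‖ ≤ √(‖P‖ * r ^ j) := by
    refine norm_le_of_mulVec _ (Real.sqrt_nonneg _) fun x => ?_
    rw [Real.sq_sqrt (by positivity)]
    refine (hP _).trans ((h1 x).trans ?_)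
    have := (le_abs_self _).trans (abs_quad_le P x)
    nlinarith
  calc ‖L ^ j‖ ^ 2 ≤ √(‖P‖ * r ^ j) ^ 2 := by gcongr
    _ = _ := Real.sq_sqrt (by positivity)

/-! ### Second moments of the state and the average cost. -/

section Performance

variable {n m : ℕ} {Ω : Type*}
  {A : Matrix (Fin n) (Fin n) ℝ} {B : Matrix (Fin n) (Fin m) ℝ}
  {K : Matrix (Fin m) (Fin n) ℝ} {x₀ : Ω → Fin n → ℝ} {w : ℕ → Ω → Fin n → ℝ}
  {σx σw : ℝ}

lemma state_succ (t : ℕ) (ω : Ω) :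
    state A B K x₀ w (t + 1) ω = (A - B * K) *ᵥ state A B K x₀ w t ω + w t ω := by
  rw [state, Matrix.sub_mulVec, Matrix.mulVec_neg, Matrix.mulVec_mulVec, sub_eq_add_neg]

lemma state_succ_apply (t : ℕ) (ω : Ω) (i : Fin n) :
    state A B K x₀ w (t + 1) ω i
      = ∑ k, (A - B * K) i k * state A B K x₀ w t ω k + w t ω i := by
  rw [state_succ]; rfl

variable [MeasurableSpace Ω] {μ : Measure Ω}

lemma memLp_state (hw : IsDisturbance μ x₀ w σx σw) (t : ℕ) (i : Fin n) :
    MemLp (fun ω => state A B K x₀ w t ω i) 2 μ := by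
  induction t generalizing i with
  | zero => exact hw.memLp_init i
  | succ t ih =>
    simp only [state_succ_apply]
    exact (memLp_finsetSum _ fun k _ => (ih k).const_mul _).add (hw.memLp_noise t i)

lemma integrable_mul_of_memLp_two {f g : Ω → ℝ} (hf : MemLp f 2 μ) (hg : MemLp g 2 μ) :
    Integrable (fun ω => f ω * g ω) μ :=
  hf.integrable_mul hg

/-- The state at time `t` involves only `x₀` and the noise strictly before `t`, hence `t ≤ s`
suffices. -/
lemma integral_state_mul_noise (hw : IsDisturbance μ x₀ w σx σw) (t s : ℕ) (hts : t ≤ s)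
    (i j : Fin n) : ∫ ω, state A B K x₀ w t ω i * w s ω j ∂μ = 0 := by
  induction t generalizing i with
  | zero => exact hw.init_noise_uncorrelated s i j
  | succ t ih =>
    have hint : ∀ k, Integrable
        (fun ω => (A - B * K) i k * (state A B K x₀ w t ω k * w s ω j)) μ := fun k =>
      (integrable_mul_of_memLp_two (memLp_state hw t k) (hw.memLp_noise s j)).const_mul _
    simp only [state_succ_apply, add_mul, Finset.sum_mul, mul_assoc]
    rw [integral_add (integrable_finsetSum _ fun k _ => hint k)
      (integrable_mul_of_memLp_two (hw.memLp_noise t i) (hw.memLp_noise s j)),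
      integral_finsetSum _ fun k _ => hint k, hw.noise_uncorrelated t s (by omega)]
    simp [integral_const_mul, ih (by omega)]

lemma integral_add_add_add {f g h k : Ω → ℝ} (hf : Integrable f μ) (hg : Integrable g μ)
    (hh : Integrable h μ) (hk : Integrable k μ) :
    ∫ ω, (f ω + g ω) + (h ω + k ω) ∂μ
      = (∫ ω, f ω ∂μ + ∫ ω, g ω ∂μ) + (∫ ω, h ω ∂μ + ∫ ω, k ω ∂μ) := by
  rw [integral_add (f := fun ω => f ω + g ω) (g := fun ω => h ω + k ω) (hf.add hg) (hh.add hk),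
    integral_add hf hg,
    integral_add hh hk]

/-- The second moment matrix of a random vector. -/
noncomputable def secondMoment (μ : Measure Ω) (x : Ω → Fin n → ℝ) : Matrix (Fin n) (Fin n) ℝ :=
  Matrix.of fun i j => ∫ ω, x ω i * x ω j ∂μ

lemma secondMoment_state_succ (hw : IsDisturbance μ x₀ w σx σw) (t : ℕ) :
    secondMoment μ (state A B K x₀ w (t + 1))
      = (A - B * K) * secondMoment μ (state A B K x₀ w t) * (A - B * K)ᵀ + σw ^ 2 • 1 := by
  ext i j
  set L := A - B * K
  set x := state A B K x₀ w t
  have hx := memLp_state (A := A) (B := B) (K := K) hw t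
  have hn := hw.memLp_noise t
  have hy : ∀ i, MemLp (fun ω => ∑ k, L i k * x ω k) 2 μ := fun i =>
    memLp_finsetSum _ fun k _ => (hx k).const_mul _
  have hyn : ∀ i j, ∫ ω, (∑ k, L i k * x ω k) * w t ω j ∂μ = 0 := fun i j => by
    simp only [Finset.sum_mul, mul_assoc]
    rw [integral_finsetSum _ fun k _ =>
      (integrable_mul_of_memLp_two (hx k) (hn j)).const_mul _]
    simp [integral_const_mul, integral_state_mul_noise hw t t le_rfl]
  have hyy : ∫ ω, (∑ k, L i k * x ω k) * (∑ l, L j l * x ω l) ∂μ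
      = (L * secondMoment μ x * Lᵀ) i j := by
    have h1 : ∀ ω, (∑ k, L i k * x ω k) * (∑ l, L j l * x ω l)
        = ∑ l, ∑ k, (L i k * L j l) * (x ω k * x ω l) := fun ω => by
      rw [Finset.sum_mul_sum, Finset.sum_comm]
      exact Finset.sum_congr rfl fun l _ => Finset.sum_congr rfl fun k _ => by ring
    have hint : ∀ l k, Integrable (fun ω => (L i k * L j l) * (x ω k * x ω l)) μ := fun l k =>
      (integrable_mul_of_memLp_two (hx k) (hx l)).const_mul _
    simp only [h1]
    rw [integral_finsetSum _ fun l _ => integrable_finsetSum _ fun k _ => hint l k,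
      Matrix.mul_apply]
    refine Finset.sum_congr rfl fun l _ => ?_
    rw [integral_finsetSum _ fun k _ => hint l k, Matrix.mul_apply, Finset.sum_mul]
    refine Finset.sum_congr rfl fun k _ => ?_
    rw [integral_const_mul]
    simp only [secondMoment, Matrix.of_apply, Matrix.transpose_apply]
    ring
  have hsplit : ∀ ω, state A B K x₀ w (t + 1) ω i * state A B K x₀ w (t + 1) ω j
      = ((∑ k, L i k * x ω k) * (∑ l, L j l * x ω l) + (∑ k, L i k * x ω k) * w t ω j)
        + ((∑ l, L j l * x ω l) * w t ω i + w t ω i * w t ω j) := fun ω => by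
    rw [state_succ_apply, state_succ_apply]; ring
  simp only [secondMoment, Matrix.of_apply, hsplit]
  have i1 := integrable_mul_of_memLp_two (hy i) (hy j)
  have i2 := integrable_mul_of_memLp_two (hy i) (hn j)
  have i3 := integrable_mul_of_memLp_two (hy j) (hn i)
  have i4 := integrable_mul_of_memLp_two (hn i) (hn j)
  rw [integral_add_add_add i1 i2 i3 i4, hyn, hyn, hyy, hw.cov_noise]
  simp [secondMoment, Matrix.one_apply]

lemma stageCost_eq_quad {Q : Matrix (Fin n) (Fin n) ℝ} {R : Matrix (Fin m) (Fin m) ℝ}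
    (x : Fin n → ℝ) : stageCost Q R x (-(K *ᵥ x)) = quad (Q + Kᵀ * R * K) x := by
  rw [quad_add, quad_transpose_mul_mul]
  simp [stageCost, quad, Matrix.mulVec_neg]

lemma quad_eq_sum (M : Matrix (Fin n) (Fin n) ℝ) (x : Fin n → ℝ) :
    quad M x = ∑ i, ∑ j, M i j * (x j * x i) := by
  simp only [quad, dotProduct, Matrix.mulVec, Finset.mul_sum]
  exact Finset.sum_congr rfl fun i _ => Finset.sum_congr rfl fun j _ => by ring

lemma integrable_quad {x : Ω → Fin n → ℝ} (hx : ∀ i, MemLp (fun ω => x ω i) 2 μ)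
    (M : Matrix (Fin n) (Fin n) ℝ) : Integrable (fun ω => quad M (x ω)) μ := by
  simp only [quad_eq_sum]
  exact integrable_finsetSum _ fun i _ => integrable_finsetSum _ fun j _ =>
    (integrable_mul_of_memLp_two (hx j) (hx i)).const_mul _

lemma integral_quad {x : Ω → Fin n → ℝ} (hx : ∀ i, MemLp (fun ω => x ω i) 2 μ)
    (M : Matrix (Fin n) (Fin n) ℝ) :
    ∫ ω, quad M (x ω) ∂μ = (M * secondMoment μ x).trace := by
  have hint : ∀ i j, Integrable (fun ω => M i j * (x ω j * x ω i)) μ := fun i j =>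
    (integrable_mul_of_memLp_two (hx j) (hx i)).const_mul _
  simp only [quad_eq_sum]
  rw [integral_finsetSum _ fun i _ => integrable_finsetSum _ fun j _ => hint i j, Matrix.trace]
  refine Finset.sum_congr rfl fun i _ => ?_
  rw [integral_finsetSum _ fun j _ => hint i j, Matrix.diag_apply, Matrix.mul_apply]
  refine Finset.sum_congr rfl fun j _ => ?_
  rw [integral_const_mul]
  rfl

/-- `σw² Γ` is a fixed point of the covariance recursion, and the deviation from it evolves as `Lᵗ
(·) (Lᵗ)ᵀ`. -/
lemma tendsto_secondMoment (hw : IsDisturbance μ x₀ w σx σw) {C r : ℝ} (hr0 : 0 ≤ r) (hr1 : r < 1)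
    (h : ∀ j, ‖(A - B * K) ^ j‖ ^ 2 ≤ C * r ^ j) :
    Tendsto (fun t => secondMoment μ (state A B K x₀ w t)) atTop
      (𝓝 (σw ^ 2 • gramian (A - B * K))) := by
  set L := A - B * K with hL
  set S := fun t => secondMoment μ (state A B K x₀ w t) with hS
  have hfix := gramian_eq hr0 hr1 h
  have h1 : ∀ t, S t = L ^ t * (S 0 - σw ^ 2 • gramian L) * (L ^ t)ᵀ + σw ^ 2 • gramian L := by
    intro t
    induction t with
    | zero => simp
    | succ t ih =>
      have h2 : S (t + 1) = L * S t * Lᵀ + σw ^ 2 • 1 := secondMoment_state_succ hw t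
      have h3 : σw ^ 2 • gramian L = L * (σw ^ 2 • gramian L) * Lᵀ + σw ^ 2 • 1 := by
        conv_lhs => rw [hfix]
        simp [smul_add]
      rw [h2, ih, pow_succ' L t, Matrix.transpose_mul, mul_add, add_mul, add_assoc, ← h3]
      simp only [mul_assoc]
  have hp := tendsto_pow_of_norm_sq_le hr0 hr1 h
  have hpt : Tendsto (fun t => (L ^ t)ᵀ) atTop (𝓝 0) := by
    have := ((continuous_id.matrix_transpose).tendsto (0 : Matrix (Fin n) (Fin n) ℝ)).comp hp
    rwa [id, Matrix.transpose_zero] at this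
  have := ((hp.mul_const (S 0 - σw ^ 2 • gramian L)).mul hpt).add_const (σw ^ 2 • gramian L)
  simp only [zero_mul, zero_add] at this
  exact this.congr fun t => (h1 t).symm

/-- The expected stage cost is linear in the second moment and so converges; Cesàro averaging keeps
the limit. -/
lemma hasAveragePerformance_of_decay (hw : IsDisturbance μ x₀ w σx σw)
    (Q : Matrix (Fin n) (Fin n) ℝ) (R : Matrix (Fin m) (Fin m) ℝ) {C r : ℝ}
    (hr0 : 0 ≤ r) (hr1 : r < 1) (h : ∀ j, ‖(A - B * K) ^ j‖ ^ 2 ≤ C * r ^ j) :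
    HasAveragePerformance μ A B Q R x₀ w K
      (σw ^ 2 * ((Q + Kᵀ * R * K) * gramian (A - B * K)).trace) := by
  have hc : Continuous fun S : Matrix (Fin n) (Fin n) ℝ => ((Q + Kᵀ * R * K) * S).trace :=
    (continuous_const.matrix_mul continuous_id).matrix_trace
  have h1 := ((hc.tendsto _).comp (tendsto_secondMoment hw hr0 hr1 h)).cesaro
  simp only [Matrix.mul_smul, Matrix.trace_smul, smul_eq_mul] at h1
  refine h1.congr fun T => ?_
  simp only [stageCost_eq_quad]
  rw [integral_finsetSum _ fun t _ => integrable_quad (memLp_state hw t) _, one_div]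
  congr 1
  exact Finset.sum_congr rfl fun t _ => (integral_quad (memLp_state hw t) _).symm

end Performance

/-! ### Perturbation around the optimal gain. -/

section Receding

variable {n m : ℕ} {A : Matrix (Fin n) (Fin n) ℝ} {B : Matrix (Fin n) (Fin m) ℝ}
  {Q : Matrix (Fin n) (Fin n) ℝ} {R : Matrix (Fin m) (Fin m) ℝ}
  {Pstar : Matrix (Fin n) (Fin n) ℝ}

lemma posDef_of_sub_one {k : ℕ} {M : Matrix (Fin k) (Fin k) ℝ} (h : (M - 1).PosSemidef) :
    M.PosDef := by
  simpa using Matrix.PosDef.posSemidef_add h Matrix.PosDef.one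

lemma dotProduct_self_le_quad {k : ℕ} {M : Matrix (Fin k) (Fin k) ℝ} (h : (M - 1).PosSemidef)
    (x : Fin k → ℝ) : x ⬝ᵥ x ≤ quad M x := by
  have := quad_nonneg h x
  rw [quad_sub, quad_one] at this
  linarith

lemma IsDARESolution.quad_closedLoop_add_le (hP : IsDARESolution A B Q R Pstar) (hR : R.PosDef)
    (x : Fin n → ℝ) :
    quad Pstar ((A - B * gain A B R Pstar) *ᵥ x) + quad Q x ≤ quad Pstar x := by
  have h : quad Pstar x = _ :=
    congrArg (quad · x) (hP.eq.trans (riccatiMap_eq_costMap hR hP.posDef.posSemidef))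
  simp only [quad_costMap] at h
  linarith [quad_nonneg hR.posSemidef (gain A B R Pstar *ᵥ x)]

lemma IsDARESolution.quad_le (hP : IsDARESolution A B Q R Pstar) (hR : R.PosDef)
    (x : Fin n → ℝ) : quad Q x ≤ quad Pstar x := by
  linarith [hP.quad_closedLoop_add_le hR x,
    quad_nonneg hP.posDef.posSemidef ((A - B * gain A B R Pstar) *ᵥ x)]

lemma IsDARESolution.norm_closedLoop_le (hP : IsDARESolution A B Q R Pstar) (hR : R.PosDef)
    (hQ : (Q - 1).PosSemidef) : ‖A - B * gain A B R Pstar‖ ≤ √‖Pstar‖ := by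
  refine Real.le_sqrt_of_sq_le ?_
  have := norm_pow_sq_le_of_lyapunov (L := A - B * gain A B R Pstar) (P := Pstar) zero_le_one
    (fun x => (dotProduct_self_le_quad hQ x).trans (hP.quad_le hR x))
    (fun x => by
      linarith [hP.quad_closedLoop_add_le hR x, quad_nonneg (posDef_of_sub_one hQ).posSemidef x]) 1
  simpa using this

lemma IsDARESolution.one_le_norm (hn : 0 < n) (hP : IsDARESolution A B Q R Pstar)
    (hR : R.PosDef) (hQ : (Q - 1).PosSemidef) : 1 ≤ ‖Pstar‖ := by
  have h1 := (dotProduct_self_le_quad hQ _).trans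
    ((hP.quad_le hR (Pi.single ⟨0, hn⟩ 1)).trans ((le_abs_self _).trans (abs_quad_le _ _)))
  simpa using h1

lemma IsDARESolution.mul_norm_gain_sub_le (hP : IsDARESolution A B Q R Pstar) (hR : R.PosDef)
    (hQ : (Q - 1).PosSemidef) {F : Matrix (Fin n) (Fin n) ℝ} (hF : F.PosSemidef) {ρ : ℝ}
    (hρ : 0 ≤ ρ) (hρR : ∀ x, ρ * (x ⬝ᵥ x) ≤ quad R x) :
    ρ * ‖gain A B R F - gain A B R Pstar‖ ≤ ‖B‖ * ‖F - Pstar‖ * √‖Pstar‖ := by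
  have h1 : ∀ x, ρ * (x ⬝ᵥ x) ≤ quad (R + Bᵀ * F * B) x := fun x => by
    rw [quad_add]
    linarith [hρR x, quad_nonneg (posSemidef_transpose_mul_mul hF B) x]
  refine (mul_norm_le_norm_mul hρ h1 _).trans ?_
  rw [mul_gain_sub_gain hR hF hP.posDef.posSemidef]
  refine (Matrix.l2_opNorm_mul _ _).trans ?_
  gcongr
  · refine (Matrix.l2_opNorm_mul _ _).trans ?_
    rw [norm_transpose]
  · exact hP.norm_closedLoop_le hR hQ

/-- A gain close to the optimal one inherits the Lyapunov function of the optimal closed loop. -/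
lemma IsDARESolution.quad_perturbed_le (hP : IsDARESolution A B Q R Pstar) (hR : R.PosDef)
    (hQ : (Q - 1).PosSemidef) (hp : 1 ≤ ‖Pstar‖) (K : Matrix (Fin m) (Fin n) ℝ) {e : ℝ}
    (he : ‖B * (K - gain A B R Pstar)‖ ≤ e)
    (hsmall : 2 * e * ‖Pstar‖ * √‖Pstar‖ + ‖Pstar‖ * e ^ 2 ≤ 1 / 2) (x : Fin n → ℝ) :
    quad Pstar ((A - B * K) *ᵥ x) ≤ (1 - 1 / (2 * ‖Pstar‖)) * quad Pstar x := by
  set p := ‖Pstar‖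
  set Ls := A - B * gain A B R Pstar with hLs
  set E := -(B * (K - gain A B R Pstar)) with hE
  have he0 : 0 ≤ e := (norm_nonneg _).trans he
  have heE : ‖E‖ ≤ e := by rwa [hE, norm_neg]
  have h1 : A - B * K = Ls + E := by
    rw [hLs, hE, Matrix.mul_sub]; abel
  set s := ‖WithLp.toLp 2 x‖ with hs
  have hxs : x ⬝ᵥ x = s ^ 2 := dotProduct_self_eq_norm_sq x
  have hEx : ‖WithLp.toLp 2 (E *ᵥ x)‖ ≤ e * s := (norm_toLp_mulVec_le _ _).trans (by gcongr)
  have hLx : ‖WithLp.toLp 2 (Ls *ᵥ x)‖ ≤ √p * s :=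
    (norm_toLp_mulVec_le _ _).trans (by gcongr; exact hP.norm_closedLoop_le hR hQ)
  have hPLx : ‖WithLp.toLp 2 (Pstar *ᵥ (Ls *ᵥ x))‖ ≤ p * (√p * s) :=
    (norm_toLp_mulVec_le _ _).trans (by gcongr)
  have h2 : (E *ᵥ x) ⬝ᵥ (Pstar *ᵥ (Ls *ᵥ x)) ≤ (e * s) * (p * (√p * s)) :=
    (le_abs_self _).trans ((abs_dotProduct_le _ _).trans (by gcongr))
  have h3 : quad Pstar (E *ᵥ x) ≤ p * (e * s) ^ 2 := by
    refine (le_abs_self _).trans ((abs_quad_le _ _).trans ?_)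
    rw [dotProduct_self_eq_norm_sq]
    gcongr
  have h4 := hP.quad_closedLoop_add_le hR x
  have h5 := dotProduct_self_le_quad hQ x
  have h6 : quad Pstar x ≤ p * s ^ 2 := by
    rw [← hxs]; exact (le_abs_self _).trans (abs_quad_le _ _)
  -- Of the decrease `s²`, at most half is lost to the perturbation; the other half is turned into a
  -- fraction of `P⋆`.
  have h7 : 1 / (2 * p) * quad Pstar x ≤ s ^ 2 / 2 := by
    have hp0 : 0 < p := by linarith
    calc 1 / (2 * p) * quad Pstar x ≤ 1 / (2 * p) * (p * s ^ 2) := by gcongr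
      _ = s ^ 2 / 2 := by field_simp
  rw [h1, Matrix.add_mulVec, quad_add_vec (isSymm_of_posSemidef hP.posDef.posSemidef)]
  have h8 := mul_le_mul_of_nonneg_right hsmall (sq_nonneg s)
  nlinarith

/-- Pair `Q + Kᵀ R K = P⋆ - Lᵀ P⋆ L + Xᵀ G X` with `Γ`; by `L Γ Lᵀ = Γ - 1` the first two terms
leave `tr P⋆`. -/
lemma trace_costMatrix_mul_gramian (hP : IsDARESolution A B Q R Pstar) (hR : R.PosDef)
    (K : Matrix (Fin m) (Fin n) ℝ) {C r : ℝ} (hr0 : 0 ≤ r) (hr1 : r < 1)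
    (h : ∀ j, ‖(A - B * K) ^ j‖ ^ 2 ≤ C * r ^ j) :
    ((Q + Kᵀ * R * K) * gramian (A - B * K)).trace = Pstar.trace +
      ((R + Bᵀ * Pstar * B) * ((K - gain A B R Pstar) * gramian (A - B * K) *
        (K - gain A B R Pstar)ᵀ)).trace := by
  have h1 := costMap_eq_riccatiMap_add (A := A) (B := B) (Q := Q) hR hP.posDef.posSemidef K
  rw [← hP.eq, costMap] at h1
  set L := A - B * K
  set X := K - gain A B R Pstar
  set G := R + Bᵀ * Pstar * B
  have h2 : Q + Kᵀ * R * K = Pstar - Lᵀ * Pstar * L + Xᵀ * G * X := by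
    rw [sub_add_eq_add_sub, ← h1]; abel
  have h3 : (Lᵀ * Pstar * L * gramian L).trace = (Pstar * (L * gramian L * Lᵀ)).trace := by
    rw [Matrix.mul_assoc, Matrix.mul_assoc, Matrix.trace_mul_comm]
    simp only [Matrix.mul_assoc]
  have h4 : (Xᵀ * G * X * gramian L).trace = (G * (X * gramian L * Xᵀ)).trace := by
    rw [Matrix.mul_assoc, Matrix.mul_assoc, Matrix.trace_mul_comm]
    simp only [Matrix.mul_assoc]
  have h5 : L * gramian L * Lᵀ = gramian L - 1 := by
    conv_rhs => rw [gramian_eq hr0 hr1 h]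
    simp
  rw [h2, Matrix.add_mul, Matrix.sub_mul, Matrix.trace_add, Matrix.trace_sub, h3, h4, h5,
    Matrix.mul_sub, Matrix.trace_sub]
  simp

lemma decayParam_mul_quad_le (hn : 0 < n) (hQ : Q.PosDef) (x : Fin n → ℝ) :
    quad Pstar x ≤ decayParam Pstar Q * quad Q x := by
  have hq := sigmaMin_pos hn hQ
  have h1 := (le_abs_self _).trans (abs_quad_le Pstar x)
  have h2 := sigmaMin_mul_le_quad hQ.posSemidef x
  have h3 := norm_le_sigmaMax Pstar
  have hx := zero_le_dotProduct_self x
  have hs : 0 ≤ sigmaMax Pstar := (norm_nonneg _).trans h3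
  calc quad Pstar x ≤ sigmaMax Pstar * (x ⬝ᵥ x) := h1.trans (by gcongr)
    _ = decayParam Pstar Q * (sigmaMin Q * (x ⬝ᵥ x)) := by
      rw [decayParam]; field_simp
    _ ≤ _ := by
      have : 0 ≤ decayParam Pstar Q := div_nonneg hs hq.le
      gcongr

lemma IsDARESolution.one_le_decayParam (hn : 0 < n) (hP : IsDARESolution A B Q R Pstar)
    (hR : R.PosDef) (hQ : Q.PosDef) : 1 ≤ decayParam Pstar Q := by
  have hne : (Pi.single ⟨0, hn⟩ 1 : Fin n → ℝ) ≠ 0 := by simp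
  have h1 : 0 < quad Q (Pi.single ⟨0, hn⟩ 1) := by
    simpa [quad] using hQ.dotProduct_mulVec_pos hne
  have h2 := (hP.quad_le hR _).trans (decayParam_mul_quad_le (Pstar := Pstar) hn hQ
    (Pi.single ⟨0, hn⟩ 1))
  exact le_of_mul_le_mul_right (by linarith) h1

/-- Passing from the norm to the relative order costs `1 / σ̲(Q)`, and returning costs `σ̄(P⋆)`;
together they give the prefactor `β`. -/
lemma IsDARESolution.norm_riccatiMap_iterate_sub_le (hn : 0 < n)
    (hP : IsDARESolution A B Q R Pstar) (hR : R.PosDef) (hQ : Q.PosDef)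
    {P : Matrix (Fin n) (Fin n) ℝ} (hPpsd : P.PosSemidef) {ε : ℝ} (hε : ‖P - Pstar‖ ≤ ε) (i : ℕ) :
    ‖(riccatiMap A B Q R)^[i] P - Pstar‖
      ≤ decayParam Pstar Q * (1 - (decayParam Pstar Q)⁻¹) ^ i * ε := by
  have hβ := hP.one_le_decayParam hn hR hQ
  set β := decayParam Pstar Q with hβdef
  have hβ0 : 0 < β := by linarith
  have hε0 : 0 ≤ ε := (norm_nonneg _).trans hε
  have hq := sigmaMin_pos hn hQ
  have hb : β⁻¹ ≤ 1 := inv_le_one_of_one_le₀ hβ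
  have hc : 0 ≤ (1 - β⁻¹) ^ i := pow_nonneg (sub_nonneg.2 hb) i
  have h1 : ∀ x, |quad (P - Pstar) x| ≤ ε / sigmaMin Q * quad Pstar x := fun x => by
    have h2 := sigmaMin_mul_le_quad hQ.posSemidef x
    have hx := zero_le_dotProduct_self x
    calc |quad (P - Pstar) x| ≤ ε * (x ⬝ᵥ x) := (abs_quad_le _ x).trans (by gcongr)
      _ = ε / sigmaMin Q * (sigmaMin Q * (x ⬝ᵥ x)) := by field_simp
      _ ≤ _ := by
        gcongr
        exact h2.trans (hP.quad_le hR x)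
  have h2 := abs_quad_riccatiMap_iterate_sub_le hQ.posSemidef hR hP.posDef.posSemidef hP.eq hb
    (fun x => by
      rw [inv_mul_le_iff₀ hβ0]
      exact decayParam_mul_quad_le hn hQ x) hPpsd (by positivity) h1 i
  refine norm_le_of_abs_quad_le ?_ (by positivity) fun x => (h2 x).trans ?_
  · rw [Matrix.transpose_sub, isSymm_of_posSemidef hP.posDef.posSemidef, isSymm_of_posSemidef
      (posSemidef_riccatiMap_iterate hQ.posSemidef hR hPpsd i)]
  · have h3 := (le_abs_self _).trans (abs_quad_le Pstar x)
    have hx := zero_le_dotProduct_self x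
    calc ε / sigmaMin Q * (1 - β⁻¹) ^ i * quad Pstar x
        ≤ ε / sigmaMin Q * (1 - β⁻¹) ^ i * (sigmaMax Pstar * (x ⬝ᵥ x)) := by
          gcongr
          exact h3.trans (by gcongr; exact norm_le_sigmaMax _)
      _ = β * (1 - β⁻¹) ^ i * ε * (x ⬝ᵥ x) := by
          rw [show β = sigmaMax Pstar / sigmaMin Q from hβdef]; ring

lemma trace_gain_deviation_le {Γ : Matrix (Fin n) (Fin n) ℝ} (G : Matrix (Fin m) (Fin m) ℝ)
    (X : Matrix (Fin m) (Fin n) ℝ) {g ξ γ : ℝ} (hG : ‖G‖ ≤ g) (hX : ‖X‖ ≤ ξ) (hΓ : ‖Γ‖ ≤ γ) :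
    (G * (X * Γ * Xᵀ)).trace ≤ m * (g * (ξ * γ * ξ)) := by
  have hg := (norm_nonneg _).trans hG
  have hξ := (norm_nonneg _).trans hX
  have hγ := (norm_nonneg _).trans hΓ
  refine (trace_le _).trans ?_
  gcongr
  refine (Matrix.l2_opNorm_mul _ _).trans ?_
  gcongr
  refine (Matrix.l2_opNorm_mul _ _).trans ?_
  rw [norm_transpose]
  gcongr
  refine (Matrix.l2_opNorm_mul _ _).trans ?_
  gcongr

lemma norm_add_transpose_mul_mul_le {Υ : ℝ} (hB : ‖B‖ ≤ Υ) (hP : ‖Pstar‖ ≤ Υ) :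
    ‖R + Bᵀ * Pstar * B‖ ≤ sigmaMax R + Υ ^ 3 := by
  have hΥ := (norm_nonneg _).trans hB
  refine (norm_add_le _ _).trans (add_le_add (norm_le_sigmaMax R) ?_)
  refine (Matrix.l2_opNorm_mul _ _).trans ?_
  calc ‖Bᵀ * Pstar‖ * ‖B‖ ≤ (‖Bᵀ‖ * ‖Pstar‖) * ‖B‖ := by
        gcongr; exact Matrix.l2_opNorm_mul _ _
    _ ≤ (Υ * Υ) * Υ := by rw [norm_transpose]; gcongr
    _ = Υ ^ 3 := by ring

end Receding

/-! ### Dimension zero and scalar estimates. -/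

lemma norm_pow_sq_le_of_isEmpty (L : Matrix (Fin 0) (Fin 0) ℝ) (j : ℕ) :
    ‖L ^ j‖ ^ 2 ≤ 0 * (0 : ℝ) ^ j := by
  rw [Subsingleton.elim (L ^ j) 0]; simp

lemma perturbation_bound {p Υ e : ℝ} (hp : 1 ≤ p) (hpΥ : p ≤ Υ) (he0 : 0 ≤ e)
    (he : e ≤ 1 / (40 * Υ ^ 2 * p)) : 2 * e * p * √p + p * e ^ 2 ≤ 1 / 2 := by
  have hΥ : 1 ≤ Υ := hp.trans hpΥ
  rw [le_div_iff₀ (by positivity)] at he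
  have hs : √p ≤ p := Real.sqrt_le_iff.2 ⟨by linarith, by nlinarith⟩
  have h1 : e * p * Υ ≤ 1 / 40 := by
    nlinarith [mul_nonneg (mul_nonneg he0 (by linarith : 0 ≤ p)) (mul_nonneg (by linarith : 0 ≤ Υ)
      (sub_nonneg.2 hΥ))]
  have h2 : e * p * √p ≤ 1 / 40 := le_trans (by gcongr; linarith) h1
  have h3 : e * p ≤ 1 / 40 := le_trans (le_mul_of_one_le_right (by positivity) hΥ) h1
  have h4 : e ≤ 1 / 40 := le_trans (le_mul_of_one_le_right he0 hp) h3
  nlinarith [mul_le_mul h3 h4 he0 (by norm_num)]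

lemma suboptimality_bound {p Υ d : ℝ} (hp : 1 ≤ p) (hpΥ : p ≤ Υ) :
    (Υ * d * √p) * (2 * p ^ 2) * (Υ * d * √p) ≤
      32 * Υ ^ 4 * (√p + 1) ^ 2 * p * d ^ 2 := by
  have hp0 : 0 ≤ p := by linarith
  have hΥ : 1 ≤ Υ := hp.trans hpΥ
  have h1 : (Υ * d * √p) * (2 * p ^ 2) * (Υ * d * √p) = 2 * Υ ^ 2 * p ^ 2 * p * d ^ 2 := by
    linear_combination (2 * Υ ^ 2 * d ^ 2 * p ^ 2) * Real.sq_sqrt hp0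
  rw [h1]
  have h2 : 1 ≤ (√p + 1) ^ 2 := by nlinarith [Real.sqrt_nonneg p]
  calc 2 * Υ ^ 2 * p ^ 2 * p * d ^ 2 ≤ 32 * Υ ^ 2 * Υ ^ 2 * p * d ^ 2 := by gcongr; norm_num
    _ = 32 * Υ ^ 4 * 1 * p * d ^ 2 := by ring
    _ ≤ _ := by gcongr

end LQRHC

/-! ### The main theorem. -/

theorem theorem1 {n m : ℕ} (hmn : m ≤ n)
    (A : Matrix (Fin n) (Fin n) ℝ) (B : Matrix (Fin n) (Fin m) ℝ)
    (Q : Matrix (Fin n) (Fin n) ℝ) (R : Matrix (Fin m) (Fin m) ℝ)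
    (hR : (R - 1).PosSemidef) (hQ : (Q - 1).PosSemidef)
    (hAB : LQRHC.Stabilizable A B)
    (Pstar : Matrix (Fin n) (Fin n) ℝ) (hPstar : LQRHC.IsDARESolution A B Q R Pstar)
    {Ω : Type*} [MeasurableSpace Ω] (μ : Measure Ω) [IsProbabilityMeasure μ]
    (x₀ : Ω → Fin n → ℝ) (w : ℕ → Ω → Fin n → ℝ) (σx σw : ℝ)
    (hw : LQRHC.IsDisturbance μ x₀ w σx σw)
    (εm εp Υ : ℝ) (hεm : 0 ≤ εm) (hΥ : max 1 εm ≤ Υ)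
    (hA : ‖A‖ ≤ Υ) (hB : ‖B‖ ≤ Υ) (hP : ‖Pstar‖ ≤ Υ)
    (N : ℕ) (hN : 1 ≤ N)
    (P : Matrix (Fin n) (Fin n) ℝ) (hPpsd : P.PosSemidef) (hPε : ‖P - Pstar‖ ≤ εp)
    (β : ℝ) (hβ : β = LQRHC.decayParam Pstar Q)
    (hsmall₁ : β * (1 - β⁻¹) ^ (N - 1) * εp ≤ Υ)
    (hsmall₂ : εm + β * (1 - β⁻¹) ^ (N - 1) * εp ≤
      LQRHC.sigmaMin R / (40 * Υ ^ 4 * ‖Pstar‖ ^ (3 / 2 : ℝ))) :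
    LQRHC.SchurStable (A - B * LQRHC.rhcGain A B Q R P N) ∧
    ∃ Jmpc Jstar : ℝ,
      LQRHC.HasAveragePerformance μ A B Q R x₀ w (LQRHC.rhcGain A B Q R P N) Jmpc ∧
      LQRHC.HasAveragePerformance μ A B Q R x₀ w (LQRHC.gain A B R Pstar) Jstar ∧
      Jmpc - Jstar ≤
        32 * (m : ℝ) * σw ^ 2 * Υ ^ 4 * (√‖Pstar‖ + 1) ^ 2 * ‖Pstar‖ *
          (LQRHC.sigmaMax R + Υ ^ 3) * β ^ 2 * (1 - β⁻¹) ^ (2 * (N - 1)) * εp ^ 2 := by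
  have hR' := LQRHC.posDef_of_sub_one hR
  have hQ' := LQRHC.posDef_of_sub_one hQ
  have hSS : (1 : ℝ) ≤ Υ := (le_max_left _ _).trans hΥ
  -- For `n = 0` the bound `1 ≤ ‖P⋆‖` fails; `m ≤ n` then makes everything empty.
  rcases Nat.eq_zero_or_pos n with rfl | hn
  · obtain rfl : m = 0 := by omega
    have hdec := LQRHC.norm_pow_sq_le_of_isEmpty
    refine ⟨LQRHC.schurStable_of_tendsto (LQRHC.tendsto_pow_of_norm_sq_le le_rfl one_pos
      (hdec _)), _, _, LQRHC.hasAveragePerformance_of_decay hw Q R le_rfl one_pos (hdec _),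
      LQRHC.hasAveragePerformance_of_decay hw Q R le_rfl one_pos (hdec _), ?_⟩
    simp [Matrix.trace]
  set p := ‖Pstar‖ with hp_def
  have hp : 1 ≤ p := hPstar.one_le_norm hn hR' hQ
  have hp0 : 0 < p := by linarith
  have hΥ0 : 0 < Υ := by linarith
  set F := (LQRHC.riccatiMap A B Q R)^[N - 1] P with hF_def
  have hF : F.PosSemidef := LQRHC.posSemidef_riccatiMap_iterate hQ'.posSemidef hR' hPpsd _
  set d := β * (1 - β⁻¹) ^ (N - 1) * εp with hd_def
  have hFd : ‖F - Pstar‖ ≤ d := by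
    rw [hd_def, hβ]
    exact hPstar.norm_riccatiMap_iterate_sub_le hn hR' hQ' hPpsd hPε _
  have hd0 : 0 ≤ d := (norm_nonneg _).trans hFd
  set K := LQRHC.rhcGain A B Q R P N
  have hbound : ‖B‖ * ‖F - Pstar‖ * √p ≤ Υ * d * √p := by gcongr
  -- Here `R ≥ I` is used only through the constant `1`; `he` keeps `σ̲(R)`, which cancels the one
  -- in the smallness assumption.
  have hX : ‖K - LQRHC.gain A B R Pstar‖ ≤ Υ * d * √p := by
    have := hPstar.mul_norm_gain_sub_le hR' hQ hF zero_le_one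
      (fun x => by simpa using LQRHC.dotProduct_self_le_quad hR x)
    rw [one_mul] at this
    exact this.trans hbound
  have he : ‖B * (K - LQRHC.gain A B R Pstar)‖ ≤ 1 / (40 * Υ ^ 2 * p) := by
    -- For `m = 0` there is no positive `σ̲(R)` to cancel, but `B (K - K⋆)` vanishes.
    rcases Nat.eq_zero_or_pos m with rfl | hm
    · have : B * (K - LQRHC.gain A B R Pstar) = 0 := by
        ext i j; simp [Matrix.mul_apply]
      rw [this, norm_zero]
      positivity
    · have hρ := LQRHC.sigmaMin_pos hm hR'
      have h1 := (hPstar.mul_norm_gain_sub_le hR' hQ hF hρ.le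
        (LQRHC.sigmaMin_mul_le_quad hR'.posSemidef)).trans hbound
      have hpow : p ^ (3 / 2 : ℝ) = p * √p := by
        rw [Real.sqrt_eq_rpow, ← Real.rpow_one_add' hp0.le (by norm_num)]
        norm_num
      have hs : 0 < √p := Real.sqrt_pos.2 hp0
      have h2 : d ≤ LQRHC.sigmaMin R / (40 * Υ ^ 4 * (p * √p)) := by
        rw [← hpow]; linarith
      have h3 : LQRHC.sigmaMin R * ‖K - LQRHC.gain A B R Pstar‖
          ≤ LQRHC.sigmaMin R * (1 / (40 * Υ ^ 3 * p)) := by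
        refine h1.trans ?_
        calc Υ * d * √p ≤ Υ * (LQRHC.sigmaMin R / (40 * Υ ^ 4 * (p * √p))) * √p := by gcongr
          _ = _ := by field_simp
      have h4 := le_of_mul_le_mul_left h3 hρ
      calc _ ≤ ‖B‖ * ‖K - LQRHC.gain A B R Pstar‖ := Matrix.l2_opNorm_mul _ _
        _ ≤ Υ * (1 / (40 * Υ ^ 3 * p)) := by gcongr
        _ = _ := by field_simp
  have hr0 : 0 ≤ 1 - 1 / (2 * p) := by
    rw [sub_nonneg, div_le_one (by positivity)]; linarith
  have hr1 : 1 - 1 / (2 * p) < 1 := by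
    have : 0 < 1 / (2 * p) := by positivity
    linarith
  have hlow : ∀ x, x ⬝ᵥ x ≤ LQRHC.quad Pstar x := fun x =>
    (LQRHC.dotProduct_self_le_quad hQ x).trans (hPstar.quad_le hR' x)
  have hdecK := LQRHC.norm_pow_sq_le_of_lyapunov hr0 hlow
    (hPstar.quad_perturbed_le hR' hQ hp K he
      (LQRHC.perturbation_bound hp hP (by positivity) le_rfl))
  -- The optimal loop is the case of zero perturbation, with the same rate.
  have hdecS := LQRHC.norm_pow_sq_le_of_lyapunov hr0 hlow
    (hPstar.quad_perturbed_le hR' hQ hp (LQRHC.gain A B R Pstar) (e := 0) (by simp) (by norm_num))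
  refine ⟨LQRHC.schurStable_of_tendsto (LQRHC.tendsto_pow_of_norm_sq_le hr0 hr1 hdecK), _, _,
    LQRHC.hasAveragePerformance_of_decay hw Q R hr0 hr1 hdecK,
    LQRHC.hasAveragePerformance_of_decay hw Q R hr0 hr1 hdecS, ?_⟩
  rw [LQRHC.trace_costMatrix_mul_gramian hPstar hR' K hr0 hr1 hdecK,
    LQRHC.trace_costMatrix_mul_gramian hPstar hR' (LQRHC.gain A B R Pstar) hr0 hr1 hdecS]
  simp only [sub_self, Matrix.zero_mul, Matrix.mul_zero, Matrix.trace_zero, add_zero]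
  -- Geometric series: `p / (1 - r)` with `r = 1 - 1 / (2 p)`.
  have hΓ : ‖LQRHC.gramian (A - B * K)‖ ≤ 2 * p ^ 2 := by
    refine (LQRHC.norm_gramian_le hr0 hr1 hdecK).trans_eq ?_
    rw [← hp_def]
    field_simp
    ring
  have htr := LQRHC.trace_gain_deviation_le _ _
    (LQRHC.norm_add_transpose_mul_mul_le (R := R) hB hP) hX hΓ
  have hg : 0 ≤ LQRHC.sigmaMax R + Υ ^ 3 :=
    (norm_nonneg _).trans (LQRHC.norm_add_transpose_mul_mul_le (R := R) hB hP)
  have hfin := LQRHC.suboptimality_bound (d := d) hp hP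
  calc _ = σw ^ 2 * _ := by rw [← mul_sub, add_sub_cancel_left]
    _ ≤ σw ^ 2 * (m * ((LQRHC.sigmaMax R + Υ ^ 3) *
        (32 * Υ ^ 4 * (√p + 1) ^ 2 * p * d ^ 2))) := by
      gcongr
      exact htr.trans (by gcongr)
    _ = _ := by rw [hd_def, pow_mul']; ring
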